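/- For integers $n\ge 2$ and $r,k,s,q\ge 1$, let $P(r,n,k,s,q)$ be the Prishchepov group \[ P(r,n,k,s,q)=\Big\langle x_0,\dots,x_{n-1}\ \Big|\ \prod_{i=0}^{r-1}x_{j+iq}\Big(\prod_{i=0}^{s-1}x_{j+k-1+iq}\Big)^{-1}\ (0\le j<n)\Big\rangle , \] where subscripts are taken modulo $n$ and each product is written from left to right in order of increasing $i$. Let $k,q\ge 1$, $\alpha,\beta\ge 0$ and $n\ge 2$ be integers such that $\gcd(n,k-1,q)=1$, and suppose that it is not the case that both $n=2$ and $\beta=\alpha+1$. Then: 1. $P(\alpha n+2,n,k,\beta n+1,q)$ is perfect (i.e. equal to its commutator subgroup) if and only if $\alpha=\beta$ and at least one of the following holds: (i) $k\equiv 1 \pmod n$; (ii) $k\equiv 1+q \pmod n$; (iii) $\gcd(n,6)=1$ and $q\equiv 2(k-1)\pmod n$. 2. $P(\alpha n+2,n,k,\beta n+1,q)$ is trivial if and only if $\alpha=\beta$ and either $k\equiv 1\pmod n$ or $k\equiv 1+q\pmod n$. -/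

import Mathlib

/-- The word `x_j x_{j+q} ⋯ x_{j+(r-1)q}` of length `r` in the free group on `x_0, …, x_{n-1}`,
with subscripts taken modulo `n`. -/
def progressionWord (n r q : ℕ) (j : ZMod n) : FreeGroup (ZMod n) :=
  ((List.range r).map fun i : ℕ => FreeGroup.of (j + (i : ZMod n) * (q : ZMod n))).prod

/-- The relator
`(x_j x_{j+q} ⋯ x_{j+(r-1)q}) (x_{j+k-1} x_{j+k-1+q} ⋯ x_{j+k-1+(s-1)q})⁻¹`. -/
def prishchepovRelator (r n k s q : ℕ) (j : ZMod n) : FreeGroup (ZMod n) :=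
  progressionWord n r q j * (progressionWord n s q (j + ((k : ZMod n) - 1)))⁻¹

/-- The Prishchepov group `P(r, n, k, s, q)`: generators `x_j` and one relator for each residue
`j` modulo `n`. -/
abbrev PrishchepovGroup (r n k s q : ℕ) : Type :=
  PresentedGroup (Set.range (prishchepovRelator r n k s q))

/-! ### Relators and homomorphisms -/

/-! Write `A = k - 1`. The abelianization is ℤ[C_n]/(F), where F = ∑_{i<r} t^(iq) - t^A ∑_{i<s}
t^(iq), so perfectness makes every value of F at a character a unit (`isUnit_of_isPerfect`). The
trivial character gives (α - β)n + 1 = ±1, hence α = β. A character modulo a prime then gives gcd(q,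
n) = 1. Now full sweeps of the residues cancel and 1 + t^q - t^A is a unit of ℤ[C_n]. A unit is ± a
group element times its conjugate, and comparing coefficients leaves A = 0, A = q, q = 2A or 2q = 0
(`eq_of_isUnit_trinomial`); the last forces n = 2, where A = 0 or A = q. If q = 2A, coprimality
excludes even n and a cube root of unity in characteristic 2 excludes 3 ∣ n.

Conversely, if A is 0 or q, each relator reduces to one generator. If q = 2A and gcd(n, 6) = 1, the
abelianized relations kill everything, but the group is not trivial: it maps nontrivially to SL₂(ℂ),
through matrices satisfying the relations of a (2, 2N + 1, n) triangle group up to sign, with N = αn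
+ 1. -/

theorem lift_progressionWord {G : Type*} [Group G] {n : ℕ} (f : ZMod n → G) (r q : ℕ)
    (j : ZMod n) :
    FreeGroup.lift f (progressionWord n r q j) =
      ((List.range r).map fun i : ℕ => f (j + (i : ZMod n) * (q : ZMod n))).prod := by
  simp [progressionWord, map_list_prod, List.map_map, Function.comp_def]

theorem lift_prishchepovRelator_eq_one_iff {G : Type*} [Group G] {n : ℕ} (f : ZMod n → G)
    (r A s q : ℕ) (j : ZMod n) :
    FreeGroup.lift f (prishchepovRelator r n (A + 1) s q j) = 1 ↔
      ((List.range r).map fun i : ℕ => f (j + (i : ZMod n) * (q : ZMod n))).prod =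
        ((List.range s).map fun i : ℕ => f (j + A + (i : ZMod n) * (q : ZMod n))).prod := by
  rw [prishchepovRelator, map_mul, map_inv, lift_progressionWord, lift_progressionWord,
    mul_inv_eq_one]
  simp

/-- The homomorphism out of a Prishchepov group given by a solution of its relations. -/
def PrishchepovGroup.lift {G : Type*} [Group G] {r n A s q : ℕ} (f : ZMod n → G)
    (h : ∀ j, ((List.range r).map fun i : ℕ => f (j + (i : ZMod n) * (q : ZMod n))).prod =
        ((List.range s).map fun i : ℕ => f (j + A + (i : ZMod n) * (q : ZMod n))).prod) :
    PrishchepovGroup r n (A + 1) s q →* G :=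
  PresentedGroup.toGroup (f := f) (by
    rintro _ ⟨j, rfl⟩
    exact (lift_prishchepovRelator_eq_one_iff f r A s q j).2 (h j))

theorem PrishchepovGroup.lift_of {G : Type*} [Group G] {r n A s q : ℕ} (f : ZMod n → G)
    (h : ∀ j, ((List.range r).map fun i : ℕ => f (j + (i : ZMod n) * (q : ZMod n))).prod =
        ((List.range s).map fun i : ℕ => f (j + A + (i : ZMod n) * (q : ZMod n))).prod)
    (j : ZMod n) :
    PrishchepovGroup.lift (r := r) (s := s) f h (PresentedGroup.of j) = f j :=
  PresentedGroup.toGroup.of _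

theorem PrishchepovGroup.relation {G : Type*} [Group G] {r n A s q : ℕ}
    (φ : PrishchepovGroup r n (A + 1) s q →* G) (j : ZMod n) :
    ((List.range r).map fun i : ℕ =>
        φ (PresentedGroup.of (j + (i : ZMod n) * (q : ZMod n)))).prod =
      ((List.range s).map fun i : ℕ =>
        φ (PresentedGroup.of (j + A + (i : ZMod n) * (q : ZMod n)))).prod := by
  rw [← lift_prishchepovRelator_eq_one_iff (fun j => φ (PresentedGroup.of j)) r A s q j]
  have : FreeGroup.lift (fun j => φ (PresentedGroup.of j)) =
      φ.comp (PresentedGroup.mk (Set.range (prishchepovRelator r n (A + 1) s q))) := by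
    ext j; simp [PresentedGroup.of]
  rw [this, MonoidHom.comp_apply, PresentedGroup.one_of_mem (Set.mem_range_self j), map_one]

theorem PrishchepovGroup.subsingleton_of_forall_of_eq_one {r n k s q : ℕ}
    (h : ∀ j, (PresentedGroup.of j : PrishchepovGroup r n k s q) = 1) :
    Subsingleton (PrishchepovGroup r n k s q) := by
  have : MonoidHom.id (PrishchepovGroup r n k s q) = 1 := PresentedGroup.ext (by simpa using h)
  exact subsingleton_of_forall_eq 1 fun g => DFunLike.congr_fun this g

theorem Group.IsPerfect.map_eq_one {G H : Type*} [Group G] [CommGroup H] [Group.IsPerfect G]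
    (φ : G →* H) (g : G) : φ g = 1 :=
  Abelianization.commutator_subset_ker φ Group.IsPerfect.mem_commutator

theorem PrishchepovGroup.isPerfect_of_forall_of_eq_one {r n k s q : ℕ}
    (h : ∀ j, Abelianization.of (PresentedGroup.of j : PrishchepovGroup r n k s q) = 1) :
    Group.IsPerfect (PrishchepovGroup r n k s q) := by
  have : (Abelianization.of : PrishchepovGroup r n k s q →* _) = 1 :=
    PresentedGroup.ext (by simpa using h)
  refine ⟨?_⟩
  rw [← Abelianization.ker_of, this]
  exact MonoidHom.ker_one

theorem Multiplicative.prod_map_ofAdd {M : Type*} [AddMonoid M] (l : List ℕ) (f : ℕ → M) :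
    (l.map fun i => Multiplicative.ofAdd (f i)).prod = Multiplicative.ofAdd (l.map f).sum := by
  induction l with
  | nil => rfl
  | cons a l ih => simp [ih]

theorem List.sum_map_range {M : Type*} [AddCommMonoid M] (r : ℕ) (f : ℕ → M) :
    ((List.range r).map f).sum = ∑ i ∈ Finset.range r, f i := rfl

/-- The value at a character of the representer polynomial of a perfect Prishchepov group is
a unit. -/
theorem PrishchepovGroup.isUnit_of_isPerfect {r n A s q : ℕ}
    (hP : Group.IsPerfect (PrishchepovGroup r n (A + 1) s q)) {R : Type*} [CommRing R]
    (τ : Multiplicative (ZMod n) →* R) :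
    IsUnit (∑ i ∈ Finset.range r, τ (.ofAdd ((i : ZMod n) * q)) -
      τ (.ofAdd (A : ZMod n)) * ∑ i ∈ Finset.range s, τ (.ofAdd ((i : ZMod n) * q))) := by
  set F := ∑ i ∈ Finset.range r, τ (.ofAdd ((i : ZMod n) * q)) -
      τ (.ofAdd (A : ZMod n)) * ∑ i ∈ Finset.range s, τ (.ofAdd ((i : ZMod n) * q)) with hF
  -- Each relator maps to τ(j)F = 0 in R/(F); perfectness then kills the class of 1 = τ(0).
  let f : ZMod n → Multiplicative (R ⧸ Ideal.span {F}) := fun j =>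
    .ofAdd (Ideal.Quotient.mk _ (τ (.ofAdd j)))
  have hf : ∀ j, ((List.range r).map fun i : ℕ => f (j + (i : ZMod n) * (q : ZMod n))).prod =
      ((List.range s).map fun i : ℕ => f (j + A + (i : ZMod n) * (q : ZMod n))).prod := by
    intro j
    simp only [f]
    rw [Multiplicative.prod_map_ofAdd, Multiplicative.prod_map_ofAdd]
    congr 1
    rw [List.sum_map_range, List.sum_map_range, ← map_sum (Ideal.Quotient.mk _), ← map_sum (Ideal.Quotient.mk _), Ideal.Quotient.eq,
      Ideal.mem_span_singleton]
    refine ⟨τ (.ofAdd j), ?_⟩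
    simp only [hF, ofAdd_add, map_mul, ← Finset.mul_sum]
    ring
  have h0 := Group.IsPerfect.map_eq_one (PrishchepovGroup.lift (r := r) (s := s) f hf)
    (PresentedGroup.of 0)
  rw [PrishchepovGroup.lift_of] at h0
  have h1 : Ideal.Quotient.mk (Ideal.span {F}) 1 = 0 := by
    have := Multiplicative.ofAdd.injective h0
    simpa using this
  rw [Ideal.Quotient.eq_zero_iff_mem, Ideal.mem_span_singleton] at h1
  exact isUnit_of_dvd_one h1

/-! ### Units of integral group rings of finite abelian groups -/

section GroupRing

open AddMonoidAlgebra

variable {M : Type*} [AddCommGroup M]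

/-- The involution of an integral group ring that inverts group elements. -/
noncomputable def AddMonoidAlgebra.inversion (M : Type*) [AddCommGroup M] :
    AddMonoidAlgebra ℤ M →+* AddMonoidAlgebra ℤ M :=
  mapDomainRingHom ℤ (negAddMonoidHom : M →+ M)

theorem AddMonoidAlgebra.inversion_single (a : M) (r : ℤ) :
    inversion M (single a r) = single (-a) r := by
  simp [inversion]

theorem AddMonoidAlgebra.inversion_inversion (x : AddMonoidAlgebra ℤ M) :
    inversion M (inversion M x) = x := by
  have : (inversion M).comp (inversion M) = RingHom.id _ := by
    ext <;> simp [inversion_single]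
  exact DFunLike.congr_fun this x

theorem AddMonoidAlgebra.coeff_inversion (x : AddMonoidAlgebra ℤ M) (a : M) :
    (inversion M x).coeff a = x.coeff (-a) := by
  rw [inversion, mapDomainRingHom_apply, coeff_mapDomain]
  exact Finsupp.mapDomain_equiv_apply (f := Equiv.neg M) _ a

theorem AddMonoidAlgebra.coeff_mul_inversion_zero [Fintype M] (x : AddMonoidAlgebra ℤ M) :
    (x * inversion M x).coeff 0 = ∑ a, x.coeff a ^ 2 := by
  rw [coeff_mul_apply_left, Finsupp.sum_fintype _ _ (by simp)]
  simp [coeff_inversion, sq]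

/-- The coefficient of x·x* at the identity is the sum of the squared coefficients of x; integers
with square sum 1 are all zero but one. -/
theorem AddMonoidAlgebra.eq_single_of_mul_inversion_eq_one [Finite M] {x : AddMonoidAlgebra ℤ M}
    (h : x * inversion M x = 1) : ∃ c, x = single c 1 ∨ x = -single c 1 := by
  classical
  have := Fintype.ofFinite M
  have h1 : ∑ a, x.coeff a ^ 2 = 1 := by
    rw [← coeff_mul_inversion_zero, h, one_def, coeff_single, Finsupp.single_eq_same]
  obtain ⟨c, -, hc⟩ : ∃ c ∈ Finset.univ, x.coeff c ^ 2 ≠ 0 :=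
    Finset.exists_ne_zero_of_sum_ne_zero (by rw [h1]; exact one_ne_zero)
  have hle : 1 ≤ x.coeff c ^ 2 := by have := sq_nonneg (x.coeff c); omega
  rw [← Finset.add_sum_erase _ _ (Finset.mem_univ c)] at h1
  have hnn : 0 ≤ ∑ a ∈ Finset.univ.erase c, x.coeff a ^ 2 :=
    Finset.sum_nonneg fun _ _ => sq_nonneg _
  have hsum : ∑ a ∈ Finset.univ.erase c, x.coeff a ^ 2 = 0 := by omega
  have hzero : ∀ a, a ≠ c → x.coeff a = 0 := fun a ha => by
    have := (Finset.sum_eq_zero_iff_of_nonneg fun _ _ => sq_nonneg _).1 hsum a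
      (Finset.mem_erase.2 ⟨ha, Finset.mem_univ a⟩)
    exact pow_eq_zero_iff two_ne_zero |>.1 this
  have hx : x = single c (x.coeff c) := by
    ext a
    rw [coeff_single]
    by_cases ha : a = c
    · subst ha; simp
    · rw [hzero a ha, Finsupp.single_eq_of_ne ha]
  refine ⟨c, ?_⟩
  have hsq : x.coeff c ^ 2 = 1 := by omega
  rcases sq_eq_one_iff.1 hsq with h | h
  · left; rwa [h] at hx
  · right; rwa [h, single_neg] at hx

/-- The quotient u = x/x* satisfies u·u* = 1, so it is ± a group element. -/
theorem AddMonoidAlgebra.eq_single_mul_inversion_of_isUnit [Finite M] {x : AddMonoidAlgebra ℤ M}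
    (hx : IsUnit x) :
    ∃ c, x = single c 1 * inversion M x ∨ x = -(single c 1 * inversion M x) := by
  obtain ⟨y, hy⟩ := hx.exists_right_inv
  have hy' : inversion M x * inversion M y = 1 := by rw [← map_mul, hy, map_one]
  have hu : x * inversion M y * inversion M (x * inversion M y) = 1 := by
    rw [map_mul, inversion_inversion]
    linear_combination (inversion M x * inversion M y) * hy + hy'
  obtain ⟨c, hc⟩ := eq_single_of_mul_inversion_eq_one hu
  refine ⟨c, hc.imp (fun hc => ?_) fun hc => ?_⟩
  · rw [← hc]; linear_combination -x * hy'
  · rw [← neg_mul, ← hc]; linear_combination -x * hy'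

theorem AddMonoidAlgebra.eq_single_mul_inversion_of_isUnit_trinomial [Finite M] {a b : M}
    (hu : IsUnit (1 + single a 1 - single b 1 : AddMonoidAlgebra ℤ M)) :
    ∃ c, (1 + single a 1 - single b 1 : AddMonoidAlgebra ℤ M) =
      single c 1 + single (c - a) 1 - single (c - b) 1 := by
  obtain ⟨c, hc⟩ := eq_single_mul_inversion_of_isUnit hu
  simp only [map_add, map_sub, map_one, inversion_single, mul_add, mul_sub, mul_one,
    single_mul_single, ← sub_eq_add_neg] at hc
  refine ⟨c, hc.resolve_right fun hc => ?_⟩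
  -- The augmentation of the trinomial is 1, which rules out the minus sign.
  have := congrArg (AddMonoidAlgebra.lift ℤ ℤ M 1) hc
  simp [AddMonoidAlgebra.lift_single] at this

/-- The exponents of a unit of the form `1 + t ^ a - t ^ b` in the integral group ring of a finite
abelian group satisfy one of four linear relations. -/
theorem AddMonoidAlgebra.eq_of_isUnit_trinomial [Finite M] {a b : M}
    (hu : IsUnit (1 + single a 1 - single b 1 : AddMonoidAlgebra ℤ M)) :
    b = 0 ∨ b = a ∨ a = 2 • b ∨ 2 • a = 0 := by
  classical
  obtain ⟨c, hc⟩ := eq_single_mul_inversion_of_isUnit_trinomial hu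
  have key : ∀ g : M, ((if 0 = g then 1 else 0) + (if a = g then 1 else 0) -
      (if b = g then 1 else 0) : ℤ) = (if c = g then 1 else 0) + (if c - a = g then 1 else 0) -
      (if c - b = g then 1 else 0) := fun g => by
    have := congrArg (fun x => x.coeff g) hc
    simpa only [one_def, coeff_add, coeff_sub, Finsupp.add_apply, Finsupp.sub_apply,
      coeff_single, Finsupp.single_apply] using this
  by_contra! hne
  obtain ⟨h0, ha, hab, haa⟩ := hne
  have ha0 : a ≠ 0 := by rintro rfl; simp at haa
  have hb := key b
  rw [if_neg h0.symm, if_neg ha.symm, if_pos rfl] at hb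
  -- The coefficient at b is -1 on the left, and only the term at c - b is negative on the right.
  have hcb : c - b = b := by
    by_contra h
    rw [if_neg h] at hb
    split_ifs at hb <;> omega
  have hc2 : c = 2 • b := by rw [two_nsmul, ← sub_eq_iff_eq_add, hcb]
  have hz := key 0
  rw [if_pos rfl, if_neg ha0, if_neg h0, hcb, if_neg h0,
    if_neg (fun h => hab (by rw [← hc2, sub_eq_zero.1 h]) : ¬ c - a = 0)] at hz
  have hc0 : c = 0 := by
    by_contra h
    simp [h] at hz
  have hka := key a
  rw [hcb, if_neg ha0.symm, if_pos rfl, if_neg ha, hc0, if_neg ha0.symm, zero_sub] at hka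
  have : -a = a := by
    by_contra h
    simp [h] at hka
  exact haa (by rw [two_nsmul]; nth_rewrite 1 [← this]; simp)

end GroupRing

/-! ### Necessary conditions for perfectness -/

section Necessary

open AddMonoidAlgebra

variable {n A q α β : ℕ}

theorem PrishchepovGroup.eq_of_isPerfect (hn : 2 ≤ n) (hexc : ¬ (n = 2 ∧ β = α + 1))
    (hP : Group.IsPerfect (PrishchepovGroup (α * n + 2) n (A + 1) (β * n + 1) q)) : α = β := by
  have h := PrishchepovGroup.isUnit_of_isPerfect hP (1 : Multiplicative (ZMod n) →* ℤ)
  simp only [MonoidHom.one_apply, Finset.sum_const, Finset.card_range, nsmul_eq_mul, mul_one,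
    one_mul, Int.isUnit_iff] at h
  push_cast at h
  rcases lt_trichotomy α β with hlt | heq | hlt
  · obtain ⟨d, rfl⟩ := Nat.exists_eq_add_of_lt hlt
    exfalso
    push_cast at h
    have h2 : ((d : ℤ) + 1) * n = 2 := by
      rcases h with h | h
      · have : ((d : ℤ) + 1) * n = 0 := by linear_combination -h
        have : (0 : ℤ) < ((d : ℤ) + 1) * n := by positivity
        omega
      · linear_combination -h
    have hd : d = 0 := by
      by_contra hd
      have : 1 ≤ d := by omega
      have : (2 : ℤ) * 2 ≤ ((d : ℤ) + 1) * n := by gcongr <;> omega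
      omega
    subst hd
    refine hexc ⟨?_, by omega⟩
    simp at h2
    omega
  · exact heq
  · obtain ⟨d, rfl⟩ := Nat.exists_eq_add_of_lt hlt
    exfalso
    push_cast at h
    have : (0 : ℤ) < ((d : ℤ) + 1) * n := by positivity
    rcases h with h | h
    · have : ((d : ℤ) + 1) * n = 0 := by linear_combination h
      omega
    · have : ((d : ℤ) + 1) * n = -2 := by linear_combination h
      omega

/-- The homomorphism from `ℤ / n` that sends `1` to a given element of order dividing `n`. -/
def ZMod.powersHomOfPowEqOne {G : Type*} [Group G] (g : G) (hg : g ^ n = 1) :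
    Multiplicative (ZMod n) →* G :=
  AddMonoidHom.toMultiplicativeLeft
    (ZMod.lift n ⟨zmultiplesHom (Additive G) (Additive.ofMul g), by
      rw [zmultiplesHom_apply, natCast_zsmul, ← ofMul_pow, hg, ofMul_one]⟩)

theorem ZMod.powersHomOfPowEqOne_natCast {G : Type*} [Group G] (g : G) (hg : g ^ n = 1) (m : ℕ) :
    ZMod.powersHomOfPowEqOne g hg (.ofAdd (m : ZMod n)) = g ^ m := by
  have : (m : ZMod n) = ((m : ℤ) : ZMod n) := by simp
  simp [powersHomOfPowEqOne, this, ZMod.lift_coe, -Int.cast_natCast]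

/-- The character of `ℤ / n` determined by the image of `1`. -/
def ZMod.characterOfPowEqOne {R : Type*} [Monoid R] (g : Rˣ) (hg : g ^ n = 1) :
    Multiplicative (ZMod n) →* R :=
  (Units.coeHom R).comp (ZMod.powersHomOfPowEqOne g hg)

theorem ZMod.characterOfPowEqOne_natCast {R : Type*} [Monoid R] (g : Rˣ) (hg : g ^ n = 1)
    (m : ℕ) : ZMod.characterOfPowEqOne g hg (.ofAdd (m : ZMod n)) = (g : R) ^ m := by
  rw [characterOfPowEqOne, MonoidHom.comp_apply, ZMod.powersHomOfPowEqOne_natCast]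
  simp

/-- If d = gcd(q, n) > 1, characters of order dividing d send t^q to 1, so F becomes (s + 1) - s·c,
with c the image of t^A. Modulo a prime dividing (s + 1)^d - s^d, the choice c = (s + 1)/s is
allowed and makes this vanish. -/
theorem PrishchepovGroup.coprime_of_isPerfect (hn : 2 ≤ n)
    (hgcd : Nat.gcd (Nat.gcd n A) q = 1)
    (hP : Group.IsPerfect (PrishchepovGroup (α * n + 2) n (A + 1) (α * n + 1) q)) :
    Nat.Coprime q n := by
  by_contra hq
  set d := Nat.gcd q n with hd
  have hdn : d ∣ n := Nat.gcd_dvd_right q n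
  have hdq : d ∣ q := Nat.gcd_dvd_left q n
  have hd0 : 0 < d := Nat.gcd_pos_of_pos_right q (by omega)
  have hd2 : 2 ≤ d := by
    have : d ≠ 1 := hq
    omega
  have hAd : Nat.Coprime A d := by
    rw [Nat.coprime_iff_gcd_eq_one, ← Nat.dvd_one, ← hgcd]
    exact Nat.dvd_gcd (Nat.dvd_gcd ((Nat.gcd_dvd_right _ _).trans hdn) (Nat.gcd_dvd_left _ _))
      ((Nat.gcd_dvd_right _ _).trans hdq)
  set s := α * n + 1 with hs
  obtain ⟨p, hp, hpd⟩ := Nat.exists_prime_and_dvd (n := (s + 1) ^ d - s ^ d) (by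
    have h1 : s ^ d + 2 ≤ (s + 1) ^ d := by
      obtain ⟨e, he⟩ : ∃ e, d = e + 1 + 1 := ⟨d - 2, by omega⟩
      rw [he]
      have h2 : s ^ (e + 1) + 1 ≤ (s + 1) ^ (e + 1) :=
        Nat.pow_lt_pow_left (Nat.lt_succ_self s) (by omega)
      have h3 : 1 ≤ s ^ (e + 1) := Nat.one_le_pow _ _ (by omega)
      calc s ^ (e + 1 + 1) + 2 ≤ (s ^ (e + 1) + 1) * (s + 1) := by
            rw [pow_succ s (e + 1)]; nlinarith
        _ ≤ (s + 1) ^ (e + 1) * (s + 1) := by gcongr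
        _ = _ := (pow_succ _ _).symm
    omega)
  have := Fact.mk hp
  have hpow : ((s : ZMod p) + 1) ^ d = (s : ZMod p) ^ d := by
    have hle : s ^ d ≤ (s + 1) ^ d := by gcongr; omega
    rw [← ZMod.natCast_eq_zero_iff, Nat.cast_sub hle, sub_eq_zero] at hpd
    exact_mod_cast hpd
  have hs0 : (s : ZMod p) ≠ 0 := by
    intro h
    rw [h, zero_pow (by omega)] at hpow
    simp at hpow
  have hs1 : (s : ZMod p) + 1 ≠ 0 := by
    intro h
    rw [h, zero_pow (by omega)] at hpow
    exact pow_ne_zero d hs0 hpow.symm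
  set c : (ZMod p)ˣ := Units.mk0 _ hs1 / Units.mk0 _ hs0 with hc
  have hcd : c ^ d = 1 := by
    rw [hc, div_pow, div_eq_one]
    ext
    simpa using hpow
  -- B inverts A modulo d, so the character with t ↦ c^B sends t^A to c.
  obtain ⟨B, -, hB⟩ := Nat.exists_mul_mod_eq_one_of_coprime hAd (by omega)
  have hcB : (c ^ B) ^ A = c := by
    rw [← pow_mul, mul_comm, ← Nat.div_add_mod (A * B) d, hB, pow_add, pow_mul, hcd]
    simp
  have hdvd : ∀ m, d ∣ m → (c ^ B) ^ m = 1 := by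
    rintro _ ⟨m, rfl⟩
    rw [← pow_mul, mul_left_comm, pow_mul, hcd, one_pow]
  have hu := PrishchepovGroup.isUnit_of_isPerfect hP
    (ZMod.characterOfPowEqOne (c ^ B) (hdvd n hdn))
  have hone : ∀ i : ℕ, ZMod.characterOfPowEqOne (c ^ B) (hdvd n hdn)
      (.ofAdd ((i : ZMod n) * q)) = 1 := fun i => by
    rw [← Nat.cast_mul, ZMod.characterOfPowEqOne_natCast, ← Units.val_pow_eq_pow_val,
      hdvd _ (hdq.mul_left i), Units.val_one]
  simp only [hone, ZMod.characterOfPowEqOne_natCast] at hu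
  rw [← Units.val_pow_eq_pow_val, hcB] at hu
  have hr : ((α * n + 2 : ℕ) : ZMod p) = s + 1 := by rw [hs]; push_cast; ring
  simp only [Finset.sum_const, Finset.card_range, nsmul_eq_mul, mul_one] at hu
  rw [hr, hc] at hu
  simp [hs0] at hu

theorem ZMod.sum_range_natCast {M : Type*} [AddCommMonoid M] [NeZero n] (f : ZMod n → M) :
    ∑ i ∈ Finset.range n, f (i : ZMod n) = ∑ j, f j := by
  obtain ⟨m, rfl⟩ := Nat.exists_eq_succ_of_ne_zero (NeZero.ne n)
  rw [Finset.sum_range]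
  exact Finset.sum_congr rfl fun i _ => congrArg f (Fin.cast_val_eq_self i)

/-- As q is a unit modulo n, any n consecutive terms visit each residue once. -/
theorem ZMod.sum_range_progression {M : Type*} [AddCommMonoid M] [NeZero n]
    (hq : Nat.Coprime q n) (f : ZMod n → M) (j : ZMod n) (α e : ℕ) :
    ∑ i ∈ Finset.range (α * n + e), f (j + (i : ZMod n) * q) =
      α • ∑ j, f j + ∑ i ∈ Finset.range e, f (j + (i : ZMod n) * q) := by
  induction α with
  | zero => simp
  | succ α ih =>
    have h : ∑ i ∈ Finset.range n, f (j + (i : ZMod n) * q) = ∑ j, f j := by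
      rw [ZMod.sum_range_natCast fun i : ZMod n => f (j + i * q)]
      exact Fintype.sum_equiv ((Units.mulRight (ZMod.unitOfCoprime q hq)).trans
        (Equiv.addLeft j)) _ _ fun i => by simp
    rw [show (α + 1) * n + e = n + (α * n + e) by ring, Finset.sum_range_add, h]
    simp only [Nat.cast_add, ZMod.natCast_self, zero_add]
    rw [ih, succ_nsmul', add_assoc]

theorem PrishchepovGroup.isUnit_of_isPerfect_of_coprime [NeZero n] (hq : Nat.Coprime q n)
    (hP : Group.IsPerfect (PrishchepovGroup (α * n + 2) n (A + 1) (α * n + 1) q))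
    {R : Type*} [CommRing R] (τ : Multiplicative (ZMod n) →* R) :
    IsUnit (1 + τ (.ofAdd (q : ZMod n)) - τ (.ofAdd (A : ZMod n))) := by
  have h := PrishchepovGroup.isUnit_of_isPerfect hP τ
  have hs := fun e => ZMod.sum_range_progression hq (fun j => τ (.ofAdd j)) 0 α e
  have hA : τ (.ofAdd (A : ZMod n)) * ∑ j : ZMod n, τ (.ofAdd j) = ∑ j : ZMod n, τ (.ofAdd j) := by
    rw [Finset.mul_sum]
    exact Fintype.sum_equiv (Equiv.addLeft (A : ZMod n)) _ _ fun j => by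
      simp [← map_mul, ← ofAdd_add]
  simp only [zero_add] at hs
  rw [hs, hs] at h
  convert h using 1
  simp only [Finset.sum_range_succ, Finset.sum_range_zero, nsmul_eq_mul]
  simp only [Nat.cast_zero, zero_mul, Nat.cast_one, one_mul, ofAdd_zero, map_one]
  linear_combination (α : R) * hA

/-- For a primitive cube root of unity w in characteristic 2 and 3 ∤ A, the value 1 + w^(2A) - w^A
equals 1 + w + w² = 0. -/
theorem PrishchepovGroup.not_three_dvd_of_isPerfect [NeZero n] (hq : Nat.Coprime q n)
    (hqA : q ≡ 2 * A [MOD n])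
    (hP : Group.IsPerfect (PrishchepovGroup (α * n + 2) n (A + 1) (α * n + 1) q)) : ¬ 3 ∣ n := by
  intro h3
  obtain ⟨w, hw⟩ := IsAlgClosed.exists_root
    (Polynomial.X ^ 2 + Polynomial.X + 1 : Polynomial (AlgebraicClosure (ZMod 2))) (by
      rw [show (Polynomial.X ^ 2 + Polynomial.X + 1 : Polynomial (AlgebraicClosure (ZMod 2))) =
        Polynomial.C 1 * Polynomial.X ^ 2 + Polynomial.C 1 * Polynomial.X + Polynomial.C 1 by simp,
        Polynomial.degree_quadratic one_ne_zero]
      decide)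
  have hw : w ^ 2 + w + 1 = 0 := by simpa using hw
  have h2 : (2 : AlgebraicClosure (ZMod 2)) = 0 := CharTwo.two_eq_zero
  have hw3 : w ^ 3 = 1 := by linear_combination (w - 1) * hw
  have hw0 : w ≠ 0 := by rintro rfl; simp at hw
  have hg : Units.mk0 w hw0 ^ 3 = 1 := by ext; simpa using hw3
  have hgm : ∀ m, 3 ∣ m → Units.mk0 w hw0 ^ m = 1 := by
    rintro _ ⟨m, rfl⟩
    rw [pow_mul, hg, one_pow]
  have hu := PrishchepovGroup.isUnit_of_isPerfect_of_coprime hq hP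
    (ZMod.characterOfPowEqOne _ (hgm n h3))
  rw [(ZMod.natCast_eq_natCast_iff _ _ _).2 hqA, ZMod.characterOfPowEqOne_natCast,
    ZMod.characterOfPowEqOne_natCast, Units.val_mk0] at hu
  have hA3 : ¬ 3 ∣ A := fun h => by
    have : 3 ∣ q := (Nat.ModEq.dvd_iff hqA h3).2 (h.mul_left 2)
    have := Nat.dvd_gcd this h3
    rw [hq] at this
    omega
  refine hu.ne_zero ?_
  have hmod : ∀ m, w ^ m = w ^ (m % 3) := fun m => by
    conv_lhs => rw [← Nat.div_add_mod m 3, pow_add, pow_mul, hw3, one_pow, one_mul]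
  rcases (by omega : A % 3 = 1 ∨ A % 3 = 2) with h | h
  · rw [hmod (2 * A), hmod A, h, Nat.mul_mod, h]
    norm_num
    linear_combination hw - w * h2
  · rw [hmod (2 * A), hmod A, h, Nat.mul_mod, h]
    norm_num
    linear_combination hw - w ^ 2 * h2

theorem PrishchepovGroup.conditions_of_isPerfect (hn : 2 ≤ n)
    (hgcd : Nat.gcd (Nat.gcd n A) q = 1) (hexc : ¬ (n = 2 ∧ β = α + 1))
    (hP : Group.IsPerfect (PrishchepovGroup (α * n + 2) n (A + 1) (β * n + 1) q)) :
    α = β ∧ (A ≡ 0 [MOD n] ∨ A ≡ q [MOD n] ∨ (Nat.gcd n 6 = 1 ∧ q ≡ 2 * A [MOD n])) := by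
  obtain rfl := PrishchepovGroup.eq_of_isPerfect hn hexc hP
  refine ⟨rfl, ?_⟩
  have hq := PrishchepovGroup.coprime_of_isPerfect hn hgcd hP
  have : NeZero n := ⟨by omega⟩
  have hu := PrishchepovGroup.isUnit_of_isPerfect_of_coprime hq hP
    (AddMonoidAlgebra.of ℤ (ZMod n))
  have hu' : IsUnit (1 + single (q : ZMod n) 1 - single (A : ZMod n) 1 :
    AddMonoidAlgebra ℤ (ZMod n)) := by simpa using hu
  simp only [← ZMod.natCast_eq_natCast_iff]
  push_cast
  by_cases hA0 : (A : ZMod n) = 0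
  · exact Or.inl hA0
  by_cases hAq : (A : ZMod n) = q
  · exact Or.inr (Or.inl hAq)
  refine Or.inr (Or.inr ?_)
  have hn2 : n ≠ 2 := by
    rintro rfl
    have hq1 : (q : ZMod 2) ≠ 0 := fun h => by
      have := ((ZMod.isUnit_iff_coprime q 2).2 hq).ne_zero
      exact this h
    revert hA0 hAq hq1
    generalize (A : ZMod 2) = a
    generalize (q : ZMod 2) = b
    revert a b
    decide
  have hqA : (q : ZMod n) = 2 * A := by
    rcases AddMonoidAlgebra.eq_of_isUnit_trinomial hu' with h | h | h | h
    · exact absurd h hA0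
    · exact absurd h hAq
    · rw [h, nsmul_eq_mul, Nat.cast_ofNat]
    · rw [nsmul_eq_mul, ((ZMod.isUnit_iff_coprime q n).2 hq).mul_left_eq_zero,
        ZMod.natCast_eq_zero_iff] at h
      have := Nat.le_of_dvd (by norm_num) h
      omega
  refine ⟨?_, hqA⟩
  have hqA' : q ≡ 2 * A [MOD n] := by
    rw [← ZMod.natCast_eq_natCast_iff]; simpa using hqA
  have h2 : ¬ 2 ∣ n := fun h2 => by
    have h : 2 ∣ q := (Nat.ModEq.dvd_iff hqA' h2).2 (Nat.dvd_mul_right _ _)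
    have := Nat.dvd_gcd h h2
    rw [hq] at this
    omega
  have h3 := PrishchepovGroup.not_three_dvd_of_isPerfect hq hqA' hP
  exact Nat.Coprime.mul_right (n := 3)
    ((Nat.Prime.coprime_iff_not_dvd Nat.prime_two).2 h2).symm
    ((Nat.Prime.coprime_iff_not_dvd Nat.prime_three).2 h3).symm

end Necessary

/-! ### Sufficient conditions -/

section Sufficient

variable {n A q α : ℕ}

theorem PrishchepovGroup.map_relation_of_coprime [NeZero n] (hq : Nat.Coprime q n) {H : Type*}
    [CommGroup H] (φ : PrishchepovGroup (α * n + 2) n (A + 1) (α * n + 1) q →* H) (j : ZMod n) :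
    φ (PresentedGroup.of j) * φ (PresentedGroup.of (j + q)) = φ (PresentedGroup.of (j + A)) := by
  have h := congrArg Additive.ofMul (PrishchepovGroup.relation φ j)
  have hs := ZMod.sum_range_progression hq
    (fun j => Additive.ofMul (φ (PresentedGroup.of j)))
  have hl : ∀ (r : ℕ) (g : ℕ → H), Additive.ofMul ((List.range r).map g).prod =
    ∑ i ∈ Finset.range r, Additive.ofMul (g i) := fun _ _ => rfl
  rw [hl, hl, hs, hs, add_left_cancel_iff] at h
  refine Additive.ofMul.injective ?_
  simpa [Finset.sum_range_succ] using h

theorem Nat.coprime_of_gcd_gcd_eq_one_of_modEq (hgcd : Nat.gcd (Nat.gcd n A) q = 1)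
    (hqA : q ≡ 2 * A [MOD n]) : Nat.Coprime A n := by
  have hdq : Nat.gcd A n ∣ q :=
    (Nat.ModEq.dvd_iff hqA (Nat.gcd_dvd_right A n)).2 ((Nat.gcd_dvd_left A n).mul_left 2)
  rw [Nat.coprime_iff_gcd_eq_one, ← Nat.dvd_one, ← hgcd]
  exact Nat.dvd_gcd (Nat.dvd_gcd (Nat.gcd_dvd_right _ _) (Nat.gcd_dvd_left _ _)) hdq

/-- A family satisfying the Sieradski relations in a commutative group is trivial when the
number of generators is coprime to `6`. -/
theorem eq_one_of_mul_eq_of_coprime_six [NeZero n] (hn6 : Nat.gcd n 6 = 1) {H : Type*}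
    [CommGroup H] {y : ZMod n → H} {c : ZMod n} (hrel : ∀ j, y j * y (j + c + c) = y (j + c))
    (j : ZMod n) : y j = 1 := by
  have h3 : ∀ j, y (j + c + c + c) = (y j)⁻¹ := fun j => by
    have h1 := hrel j
    have h2 := hrel (j + c)
    rw [eq_inv_iff_mul_eq_one]
    have h4 : y j * y (j + c + c) * y (j + c + c + c) = y (j + c + c) := by rw [h1, h2]
    rw [mul_right_comm] at h4
    rw [mul_comm]
    exact mul_eq_right.1 h4
  -- Shifting by 3c inverts y, so 6c is a period; as 6 is invertible modulo n, so is c.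
  have h6 : Function.Periodic y (6 * c) := fun j => by
    rw [show j + 6 * c = j + c + c + c + c + c + c by ring, h3, h3, inv_inv]
  have hper : Function.Periodic y c := by
    have hu : ((6 : ℕ) : ZMod n) * (((6 : ℕ) : ZMod n)⁻¹) = 1 :=
      ZMod.coe_mul_inv_eq_one 6 (Nat.Coprime.symm hn6)
    have := h6.nat_mul (((6 : ℕ) : ZMod n)⁻¹).val
    rw [ZMod.natCast_zmod_val, ← mul_assoc, mul_comm _ (6 : ZMod n)] at this
    rw [Nat.cast_ofNat] at hu this
    rwa [hu, one_mul] at this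
  have := hrel j
  rw [hper (j + c)] at this
  exact mul_eq_right.1 this

theorem PrishchepovGroup.isPerfect_of_modEq [NeZero n]
    (hgcd : Nat.gcd (Nat.gcd n A) q = 1) (hn6 : Nat.gcd n 6 = 1) (hqA : q ≡ 2 * A [MOD n]) :
    Group.IsPerfect (PrishchepovGroup (α * n + 2) n (A + 1) (α * n + 1) q) := by
  have hA := Nat.coprime_of_gcd_gcd_eq_one_of_modEq hgcd hqA
  have hn2 : Nat.Coprime 2 n := (Nat.Coprime.coprime_dvd_right (by norm_num) hn6).symm
  have hq : Nat.Coprime q n := by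
    rw [Nat.coprime_iff_gcd_eq_one, hqA.gcd_eq]
    exact Nat.Coprime.mul_left hn2 hA
  have hqA' : (q : ZMod n) = A + A := by
    rw [(ZMod.natCast_eq_natCast_iff _ _ _).2 hqA]; push_cast; ring
  refine PrishchepovGroup.isPerfect_of_forall_of_eq_one fun j => ?_
  have hrel := PrishchepovGroup.map_relation_of_coprime (α := α) (A := A) hq Abelianization.of
  exact eq_one_of_mul_eq_of_coprime_six hn6
    (y := fun j => Abelianization.of (PresentedGroup.of j)) (c := A)
    (fun j => by simpa only [hqA', ← add_assoc] using hrel j) j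

theorem PrishchepovGroup.subsingleton_of_modEq_zero (hA : A ≡ 0 [MOD n]) :
    Subsingleton (PrishchepovGroup (α * n + 2) n (A + 1) (α * n + 1) q) := by
  refine PrishchepovGroup.subsingleton_of_forall_of_eq_one fun j => ?_
  have h := PrishchepovGroup.relation
    -- The right word is an initial segment of the left one; the leftover last letter has index (j -
    -- q) + (αn + 1)q = j.
    (MonoidHom.id (PrishchepovGroup (α * n + 2) n (A + 1) (α * n + 1) q)) (j - q)
  rw [(ZMod.natCast_eq_natCast_iff _ _ _).2 hA, List.range_succ (n := α * n + 1)] at h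
  simpa using h

/-- Here the right word is the left one without its first letter x_j. -/
theorem PrishchepovGroup.subsingleton_of_modEq (hA : A ≡ q [MOD n]) :
    Subsingleton (PrishchepovGroup (α * n + 2) n (A + 1) (α * n + 1) q) := by
  refine PrishchepovGroup.subsingleton_of_forall_of_eq_one fun j => ?_
  have h := PrishchepovGroup.relation
    (MonoidHom.id (PrishchepovGroup (α * n + 2) n (A + 1) (α * n + 1) q)) j
  rw [(ZMod.natCast_eq_natCast_iff _ _ _).2 hA, List.range_succ_eq_map (n := α * n + 1),
    List.map_cons, List.prod_cons, List.map_map, Function.comp_def] at h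
  have hi : ∀ i : ℕ, j + ((i.succ : ℕ) : ZMod n) * q = j + q + (i : ZMod n) * q := fun i => by
    push_cast; ring
  simp only [hi, mul_eq_right] at h
  simpa using h

end Sufficient

/-! ### A nontrivial representation -/

section Nontrivial

variable {n A q α : ℕ}

theorem prod_range_conj_progression {G : Type*} [Group G] (τ : Multiplicative (ZMod n) →* G)
    (x : G) (j q : ZMod n) (r : ℕ) :
    ((List.range r).map fun i : ℕ =>
      τ (.ofAdd (j + (i : ZMod n) * q)) * x * (τ (.ofAdd (j + (i : ZMod n) * q)))⁻¹).prod =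
      τ (.ofAdd j) * (x * τ (.ofAdd q)) ^ r * (τ (.ofAdd q) ^ r)⁻¹ * (τ (.ofAdd j))⁻¹ := by
  have hτ : ∀ i : ℕ, τ (.ofAdd (j + (i : ZMod n) * q)) = τ (.ofAdd j) * τ (.ofAdd q) ^ i :=
    fun i => by rw [ofAdd_add, map_mul, ← nsmul_eq_mul, ofAdd_nsmul, map_pow]
  simp only [hτ]
  induction r with
  | zero => simp
  | succ r ih =>
    rw [List.range_succ, List.map_append, List.prod_append, ih]
    simp only [List.map_cons, List.map_nil, List.prod_singleton]
    rw [pow_succ (x * _), pow_succ (τ (.ofAdd q))]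
    group

/-- Send x_j to the conjugate of ba⁻¹ by τ(j), where τ(A) = a and hence τ(q) = a². The products
telescope, and since a^n = 1 every relation becomes `hbraid`. -/
theorem PrishchepovGroup.not_subsingleton_of_braid {G : Type*} [Group G] {a b : G}
    (hn : 2 ≤ n) (hA : Nat.Coprime A n) (hqA : q ≡ 2 * A [MOD n]) (ha : a ^ n = 1) (hab : b ≠ a)
    (hbraid : (b * a) ^ (α * n + 1) * b = a * (b * a) ^ (α * n + 1)) :
    ¬ Subsingleton (PrishchepovGroup (α * n + 2) n (A + 1) (α * n + 1) q) := by
  obtain ⟨B, -, hB⟩ := Nat.exists_mul_mod_eq_one_of_coprime hA (by omega)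
  have haB : (a ^ B) ^ A = a := by
    rw [← pow_mul, mul_comm, ← Nat.div_add_mod (A * B) n, hB, pow_add, pow_mul, ha]
    simp
  have hB1 : (a ^ B) ^ n = 1 := by rw [← pow_mul, mul_comm, pow_mul, ha, one_pow]
  set τ := ZMod.powersHomOfPowEqOne (a ^ B) hB1 with hτ
  have hτA : τ (.ofAdd (A : ZMod n)) = a := by rw [hτ, ZMod.powersHomOfPowEqOne_natCast, haB]
  have hτq : τ (.ofAdd (q : ZMod n)) = a ^ 2 := by
    rw [(ZMod.natCast_eq_natCast_iff _ _ _).2 hqA, hτ, ZMod.powersHomOfPowEqOne_natCast, mul_comm,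
      pow_mul, haB]
  have han : ∀ e, a ^ (2 * (α * n + e)) = a ^ (2 * e) := fun e => by
    rw [show 2 * (α * n + e) = n * (2 * α) + 2 * e by ring, pow_add, pow_mul, ha, one_pow, one_mul]
  have hx : b * a⁻¹ * a ^ 2 = b * a := by group
  have hf : ∀ j : ZMod n, ((List.range (α * n + 2)).map fun i : ℕ =>
      (fun j => τ (.ofAdd j) * (b * a⁻¹) * (τ (.ofAdd j))⁻¹) (j + (i : ZMod n) * q)).prod =
      ((List.range (α * n + 1)).map fun i : ℕ =>
      (fun j => τ (.ofAdd j) * (b * a⁻¹) * (τ (.ofAdd j))⁻¹) (j + A + (i : ZMod n) * q)).prod := by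
    intro j
    simp only
    rw [prod_range_conj_progression, prod_range_conj_progression, hτq, hx, ofAdd_add, map_mul,
      hτA, ← pow_mul, ← pow_mul, han, han, pow_succ (b * a) (α * n + 1), ← mul_assoc _ b a, hbraid]
    group
  intro hsub
  have h0 := PrishchepovGroup.lift_of
    (fun j : ZMod n => τ (.ofAdd j) * (b * a⁻¹) * (τ (.ofAdd j))⁻¹) hf 0
  rw [Subsingleton.elim (PresentedGroup.of 0) (1 : PrishchepovGroup _ _ _ _ _), map_one] at h0
  have : b * a⁻¹ = 1 := by simpa using h0.symm
  exact hab (mul_inv_eq_one.1 this)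

/-- With a = v^(-N)u and b = u⁻¹v^(N+1), ba = u⁻¹vu and both sides equal u. -/
theorem braid_of_sq_eq_pow {G : Type*} [Group G] {u v : G} {N : ℕ} (h : u ^ 2 = v ^ (2 * N + 1)) :
    ((u⁻¹ * v ^ (N + 1)) * ((v ^ N)⁻¹ * u)) ^ N * (u⁻¹ * v ^ (N + 1)) =
      ((v ^ N)⁻¹ * u) * ((u⁻¹ * v ^ (N + 1)) * ((v ^ N)⁻¹ * u)) ^ N := by
  have h1 : (u⁻¹ * v ^ (N + 1)) * ((v ^ N)⁻¹ * u) = u⁻¹ * v * u⁻¹⁻¹ := by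
    rw [pow_succ']; group
  rw [h1, conj_pow]
  have h2 : u⁻¹ * v ^ N * u⁻¹⁻¹ * (u⁻¹ * v ^ (N + 1)) = u⁻¹ * v ^ (2 * N + 1) := by
    rw [show 2 * N + 1 = N + (N + 1) by ring, pow_add v N (N + 1)]; group
  rw [h2, ← h]
  group

/-- If a = b, then v = ab = a² and u = v^N a are both powers of a. -/
theorem commute_of_inv_mul_pow_eq {G : Type*} [Group G] {u v : G} {N : ℕ}
    (h : u⁻¹ * v ^ (N + 1) = (v ^ N)⁻¹ * u) : Commute u v := by
  set a := (v ^ N)⁻¹ * u with ha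
  have hu : u = v ^ N * a := by rw [ha]; group
  have hv : v = a * a := by
    have : a * (u⁻¹ * v ^ (N + 1)) = v := by rw [ha, pow_succ]; group
    rw [h] at this
    exact this.symm
  have hav : Commute a v := by rw [hv]; exact (Commute.refl a).mul_right (Commute.refl a)
  rw [hu]
  exact ((Commute.refl v).pow_left N).mul_left hav

/-- The diagonal torus of `SL₂`. -/
def Matrix.SpecialLinearGroup.diagonalTorus (K : Type*) [Field K] :
    Kˣ →* Matrix.SpecialLinearGroup (Fin 2) K where
  toFun z := ⟨!![(z : K), 0; 0, (z : K)⁻¹], by simp⟩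
  map_one' := Subtype.ext (by simp [Matrix.one_fin_two])
  map_mul' z w := Subtype.ext (by
    change _ = !![(z : K), 0; 0, (z : K)⁻¹] * !![(w : K), 0; 0, (w : K)⁻¹]
    simp [mul_comm])

theorem Matrix.SpecialLinearGroup.coe_diagonalTorus {K : Type*} [Field K] (z : Kˣ) :
    (diagonalTorus K z : Matrix (Fin 2) (Fin 2) K) = !![(z : K), 0; 0, (z : K)⁻¹] := rfl

/-- The eigenvalues z and z⁻¹ are distinct n-th roots of unity, so the characteristic polynomial
divides X^n - 1; apply Cayley–Hamilton. -/
theorem Matrix.SpecialLinearGroup.pow_eq_one_of_trace {K : Type*} [Field K] {z : K}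
    {n : ℕ} (hz : z ^ n = 1) (hz0 : z ≠ 0) (hz2 : z ≠ z⁻¹)
    {g : Matrix.SpecialLinearGroup (Fin 2) K} (hg : (g : Matrix (Fin 2) (Fin 2) K).trace = z + z⁻¹) :
    g ^ n = 1 := by
  open Polynomial in
  have hdvd : (g : Matrix (Fin 2) (Fin 2) K).charpoly ∣ X ^ n - 1 := by
    have h1 : (g : Matrix (Fin 2) (Fin 2) K).charpoly = (X - C z) * (X - C z⁻¹) := by
      have h2 : (C z * C z⁻¹ : K[X]) = 1 := by rw [← C_mul, mul_inv_cancel₀ hz0, C_1]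
      rw [Matrix.charpoly_fin_two, hg, g.det_coe, C_add, C_1]
      linear_combination -h2
    rw [h1]
    refine IsCoprime.mul_dvd (isCoprime_X_sub_C_of_isUnit_sub (sub_ne_zero.2 hz2).isUnit) ?_ ?_
    · rw [dvd_iff_isRoot]; simp [hz]
    · rw [dvd_iff_isRoot]; simp [hz]
  obtain ⟨p, hp⟩ := hdvd
  have := congrArg (Polynomial.aeval (g : Matrix (Fin 2) (Fin 2) K)) hp
  rw [map_mul, Matrix.aeval_self_charpoly, zero_mul, map_sub, map_pow, Polynomial.aeval_X, map_one,
    sub_eq_zero] at this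
  ext1
  simpa using congrFun₂ this _ _

/-- The triangle group `(2, 2N + 1, n)` has a nonabelian representation in `SL₂(ℂ)`. -/
theorem exists_specialLinearGroup_triangle {N : ℕ} (hN : 1 ≤ N) (hn : 3 ≤ n) :
    ∃ u v : Matrix.SpecialLinearGroup (Fin 2) ℂ,
      u ^ 2 = v ^ (2 * N + 1) ∧ ((v ^ N)⁻¹ * u) ^ n = 1 ∧ ¬ Commute u v := by
  have hη := Complex.isPrimitiveRoot_exp (2 * N + 1) (by omega)
  have hζ := Complex.isPrimitiveRoot_exp n (by omega)
  generalize Complex.exp (2 * Real.pi * Complex.I / (2 * N + 1 : ℕ)) = η at hη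
  generalize Complex.exp (2 * Real.pi * Complex.I / n) = ζ at hζ
  have hζ0 : ζ ≠ 0 := hζ.ne_zero (by omega)
  have hη0 : η ≠ 0 := hη.ne_zero (by omega)
  have hζ2 : ζ ≠ ζ⁻¹ := fun h => by
    have : ζ ^ 2 = 1 := by rw [sq]; nth_rewrite 2 [h]; exact mul_inv_cancel₀ hζ0
    have := Nat.le_of_dvd (by norm_num) (hζ.dvd_of_pow_eq_one 2 this)
    omega
  have hη2 : η ^ 2 ≠ 1 := fun h => by
    have := Nat.le_of_dvd (by norm_num) (hη.dvd_of_pow_eq_one 2 h)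
    omega
  have hη1 : η ≠ 1 := fun h => hη2 (by rw [h, one_pow])
  -- The sign gives v^(2N+1) = -1, matching u² = -1 for u of trace 0 and determinant 1.
  set l : ℂˣ := -Units.mk0 η hη0 with hl
  have hlM : l ^ (2 * N + 1) = -1 := by
    rw [hl, Odd.neg_pow ⟨N, rfl⟩]
    congr 1
    ext
    simpa using hη.pow_eq_one
  set c : ℂ := ((l ^ N : ℂˣ) : ℂ) with hc
  have hc0 : c ≠ 0 := Units.ne_zero _
  have hcc : c⁻¹ - c ≠ 0 := fun h => by
    have h1 : c ^ 2 = 1 := by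
      have := congrArg (· * c) h
      simp only [sub_mul, inv_mul_cancel₀ hc0, zero_mul] at this
      linear_combination -this
    have h2 : c ^ 2 * (l : ℂ) = -1 := by
      have := congrArg (fun z : ℂˣ => (z : ℂ)) hlM
      simp only [Units.val_pow_eq_pow_val, Units.val_neg, Units.val_one] at this
      rw [hc, Units.val_pow_eq_pow_val, ← this]; ring
    rw [h1, hl] at h2
    simp only [one_mul, Units.val_neg, Units.val_mk0, neg_inj] at h2
    exact hη1 h2
  -- Chosen so that v^(-N)u has trace p(c⁻¹ - c) = ζ + ζ⁻¹.
  set p : ℂ := (ζ + ζ⁻¹) / (c⁻¹ - c) with hp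
  obtain ⟨u, hu⟩ : ∃ u : Matrix.SpecialLinearGroup (Fin 2) ℂ,
      (u : Matrix (Fin 2) (Fin 2) ℂ) = !![p, 1; -1 - p ^ 2, -p] :=
    ⟨⟨_, by rw [Matrix.det_fin_two_of]; ring⟩, rfl⟩
  refine ⟨u, Matrix.SpecialLinearGroup.diagonalTorus ℂ l, ?_, ?_, ?_⟩
  · rw [← map_pow, hlM, sq]
    refine Subtype.ext ?_
    rw [Matrix.SpecialLinearGroup.coe_mul, hu, Matrix.SpecialLinearGroup.coe_diagonalTorus,
      Matrix.mul_fin_two]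
    simp only [Units.val_neg, Units.val_one, inv_neg, inv_one]
    congr 1
    ring_nf
  · refine Matrix.SpecialLinearGroup.pow_eq_one_of_trace hζ.pow_eq_one hζ0 hζ2 ?_
    have : (ζ + ζ⁻¹) = p * (c⁻¹ - c) := by rw [hp, div_mul_cancel₀ _ hcc]
    rw [← map_pow, ← map_inv, this, Matrix.SpecialLinearGroup.coe_mul, hu,
      Matrix.SpecialLinearGroup.coe_diagonalTorus, Matrix.mul_fin_two, Matrix.trace_fin_two_of,
      Units.val_inv_eq_inv_val, ← hc, inv_inv]
    ring
  · intro h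
    -- The upper right entries of uv and vu are l⁻¹ and l, which agree only if η² = 1.
    have := congrFun₂ (congrArg Subtype.val h.eq) 0 1
    rw [Matrix.SpecialLinearGroup.coe_mul, Matrix.SpecialLinearGroup.coe_mul, hu,
      Matrix.SpecialLinearGroup.coe_diagonalTorus, Matrix.mul_fin_two, Matrix.mul_fin_two] at this
    simp [hl] at this
    have h3 : η ^ 2 = 1 := by
      field_simp at this
      linear_combination -this
    exact hη2 h3

theorem PrishchepovGroup.not_subsingleton_of_modEq (hn : 3 ≤ n) (hA : Nat.Coprime A n)
    (hqA : q ≡ 2 * A [MOD n]) :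
    ¬ Subsingleton (PrishchepovGroup (α * n + 2) n (A + 1) (α * n + 1) q) := by
  obtain ⟨u, v, h, ha, huv⟩ := exists_specialLinearGroup_triangle (N := α * n + 1) (by omega) hn
  exact PrishchepovGroup.not_subsingleton_of_braid (by omega) hA hqA ha
    (fun hab => huv (commute_of_inv_mul_pow_eq hab)) (braid_of_sq_eq_pow h)

end Nontrivial

theorem mainTheorem7 (n k q α β : ℕ) (hn : 2 ≤ n) (hk : 1 ≤ k) (hq : 1 ≤ q)
    (hgcd : Nat.gcd (Nat.gcd n (k - 1)) q = 1)
    (hexc : ¬ (n = 2 ∧ β = α + 1)) :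
    (Group.IsPerfect (PrishchepovGroup (α * n + 2) n k (β * n + 1) q) ↔
      α = β ∧ (k ≡ 1 [MOD n] ∨ k ≡ 1 + q [MOD n] ∨
        (Nat.gcd n 6 = 1 ∧ q ≡ 2 * (k - 1) [MOD n]))) ∧
    (Subsingleton (PrishchepovGroup (α * n + 2) n k (β * n + 1) q) ↔
      α = β ∧ (k ≡ 1 [MOD n] ∨ k ≡ 1 + q [MOD n])) := by
  obtain ⟨A, rfl⟩ : ∃ A, k = A + 1 := ⟨k - 1, by omega⟩
  have : NeZero n := ⟨by omega⟩
  have h0 : A + 1 ≡ 1 [MOD n] ↔ A ≡ 0 [MOD n] :=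
    ⟨fun h => Nat.ModEq.add_right_cancel' 1 (by simpa using h), fun h => by simpa using h.add_right 1⟩
  have h1 : A + 1 ≡ 1 + q [MOD n] ↔ A ≡ q [MOD n] := by
    rw [add_comm 1 q]
    exact ⟨Nat.ModEq.add_right_cancel' 1, fun h => h.add_right 1⟩
  rw [h0, h1]
  rw [Nat.add_sub_cancel] at hgcd ⊢
  have hS : ∀ α, A ≡ 0 [MOD n] ∨ A ≡ q [MOD n] →
      Subsingleton (PrishchepovGroup (α * n + 2) n (A + 1) (α * n + 1) q) := fun α h =>
    h.elim PrishchepovGroup.subsingleton_of_modEq_zero PrishchepovGroup.subsingleton_of_modEq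
  refine ⟨⟨PrishchepovGroup.conditions_of_isPerfect hn hgcd hexc, ?_⟩, fun h => ?_, ?_⟩
  · rintro ⟨rfl, h | h | ⟨h6, h⟩⟩
    · have := hS α (Or.inl h)
      infer_instance
    · have := hS α (Or.inr h)
      infer_instance
    · exact PrishchepovGroup.isPerfect_of_modEq hgcd h6 h
  · obtain ⟨rfl, hc⟩ := PrishchepovGroup.conditions_of_isPerfect hn hgcd hexc inferInstance
    refine ⟨rfl, ?_⟩
    rcases hc with hc | hc | ⟨h6, hqA⟩
    · exact Or.inl hc
    · exact Or.inr hc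
    · have hn2 : n ≠ 2 := by rintro rfl; norm_num at h6
      exact absurd h (PrishchepovGroup.not_subsingleton_of_modEq (by omega)
        (Nat.coprime_of_gcd_gcd_eq_one_of_modEq hgcd hqA) hqA)
  · rintro ⟨rfl, h⟩
    exact hS α h
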